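/- A continuum is a nonempty compact connected metrizable space, and a subcontinuum of a space is a subset that is a continuum. For a continuum $X$, let $\operatorname{Cont}(X)$ be the set of all subcontinua of $X$ with the Vietoris topology (equivalently, the Hausdorff metric topology). A continuum is indecomposable if it is not the union of two proper subcontinua, and hereditarily indecomposable if each of its subcontinua is indecomposable. A maximal order arc is a subcontinuum $\mathcal{C}$ of $\operatorname{Cont}(X)$ that is linearly ordered by inclusion, contains $X$, and contains $\{x\}$ for some $x \in X$; let $\operatorname{MOA}(X)$ be the set of maximal order arcs, with the subspace topology from $\operatorname{Cont}(\operatorname{Cont}(X))$. A continuum is nondegenerate if it has more than one point; $\simeq$ means homeomorphic, and a set is comeager if its complement is a countable union of nowhere dense sets. **Theorem.** Let $X$ be a hereditarily indecomposable continuum. If $$\{\mathcal{C} \in \operatorname{MOA}(X) \mid \text{every nondegenerate } C \in \mathcal{C} \text{ satisfies } C \simeq X\}$$ is a comeager subset of $\operatorname{MOA}(X)$ (that is, GCHEC holds for $X$), then $$\{K \in \operatorname{Cont}(X) \mid K \simeq X\}$$ is a comeager subset of $\operatorname{Cont}(X)$ (that is, $X$ is generically hereditarily equivalent, GHEC). 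-/

import Mathlib

open TopologicalSpace Topology

/-- The hyperspace `Cont(X)` of (nonempty) subcontinua of `X`, as a subspace of the space of
nonempty compact subsets of `X` with the Vietoris topology. (Metrizability of a subcontinuum is
automatic when `X` is metrizable.) -/
abbrev Subcontinua (X : Type*) [TopologicalSpace X] : Type _ :=
  {K : NonemptyCompacts X // IsConnected (K : Set X)}

/-- The set of points of a subcontinuum. -/
abbrev Subcontinua.pts {X : Type*} [TopologicalSpace X] (K : Subcontinua X) : Set X := (K.1 : Set X)

/-- A continuum is indecomposable if it is not the union of two proper subcontinua. -/
def IsIndecomposable (X : Type*) [TopologicalSpace X] : Prop :=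
  ¬ ∃ A B : Subcontinua X, A.pts ≠ Set.univ ∧ B.pts ≠ Set.univ ∧ A.pts ∪ B.pts = Set.univ

/-- A continuum is hereditarily indecomposable if each of its subcontinua is indecomposable. -/
def IsHereditarilyIndecomposable (X : Type*) [TopologicalSpace X] : Prop :=
  ∀ K : Subcontinua X, IsIndecomposable K.pts

/-- An order arc in `Cont(X)`: a subcontinuum of `Cont(X)` that is linearly ordered by
inclusion. -/
def IsOrderArc {X : Type*} [TopologicalSpace X] (C : Subcontinua (Subcontinua X)) : Prop :=
  ∀ K ∈ C.pts, ∀ L ∈ C.pts, K.pts ⊆ L.pts ∨ L.pts ⊆ K.pts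

/-- A maximal order arc: an order arc that contains the whole space and some singleton. -/
def IsMaximalOrderArc {X : Type*} [TopologicalSpace X] (C : Subcontinua (Subcontinua X)) : Prop :=
  IsOrderArc C ∧ (∃ K ∈ C.pts, K.pts = Set.univ) ∧ ∃ x : X, ∃ K ∈ C.pts, K.pts = {x}

/-- The space `MOA(X)` of maximal order arcs, as a subspace of `Cont(Cont(X))`. -/
abbrev MOA (X : Type*) [TopologicalSpace X] : Type _ :=
  {C : Subcontinua (Subcontinua X) // IsMaximalOrderArc C}

/-- `K ≃ X`: the subcontinuum `K` of `X` is homeomorphic to `X`. -/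
def IsCopy {X : Type*} [TopologicalSpace X] (K : Subcontinua X) : Prop :=
  Nonempty (K.pts ≃ₜ X)

/-- `X` is generically hereditarily equivalent: the subcontinua homeomorphic to `X` form a
comeager subset of `Cont(X)`. -/
def GHEC (X : Type*) [TopologicalSpace X] : Prop :=
  {K : Subcontinua X | IsCopy K} ∈ residual (Subcontinua X)

/-- The maximal order arcs all of whose nondegenerate elements are homeomorphic to `X` form a
comeager subset of `MOA(X)`. -/
def GCHEC (X : Type*) [TopologicalSpace X] : Prop :=
  {C : MOA X | ∀ K ∈ C.1.pts, K.pts.Nontrivial → IsCopy K} ∈ residual (MOA X)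

/-! ### Topological preliminaries -/

/-! In a hereditarily indecomposable continuum, intersecting subcontinua are comparable, so a
maximal order arc starting at `x` consists of all subcontinua through `x`. Sending an arc to its
root is thus a homeomorphism `MOA.homeomorph` from `MOA X` to `X`, and GCHEC gives a comeager set
`G` of points all of whose nondegenerate subcontinua are copies of `X`. It remains to see that a
generic subcontinuum is nondegenerate and meets `G`.

Continuity of the inverse homeomorphism makes the union of an open family of subcontinua open in
`X`. Hence a subcontinuum can be perturbed to meet a given dense open set near any of its points.
Generically, each of the countably many dense open sets defining `G` has dense trace on `K`, and
Baire's theorem inside `K` gives a point of `K` in `G`. -/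

theorem IsCompact.exists_maximal_mem {Y : Type*} [TopologicalSpace Y] [PartialOrder Y]
    [ClosedIciTopology Y] {s : Set Y} (hs : IsCompact s) (hne : s.Nonempty) :
    ∃ m, Maximal (· ∈ s) m := by
  obtain ⟨a, ha⟩ := hne
  obtain ⟨m, -, hm⟩ := zorn_le_nonempty₀ s (fun c hcs hc y hy => by
    have : Nonempty c := ⟨⟨y, hy⟩⟩
    obtain ⟨z, hz⟩ := hs.inter_iInter_nonempty (fun i : c => Set.Ici (i : Y))
      (fun i => isClosed_Ici) (fun t => by
        obtain ⟨b, hb⟩ := (hc.directedOn.directed_val).finset_le t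
        exact ⟨b, hcs b.2, Set.mem_iInter₂.2 fun i hi => hb i hi⟩)
    exact ⟨z, hz.1, fun w hw => Set.mem_iInter.1 hz.2 ⟨w, hw⟩⟩) a ha
  exact ⟨m, hm⟩

theorem IsCompact.exists_minimal_mem {Y : Type*} [TopologicalSpace Y] [PartialOrder Y]
    [ClosedIicTopology Y] {s : Set Y} (hs : IsCompact s) (hne : s.Nonempty) :
    ∃ m, Minimal (· ∈ s) m :=
  IsCompact.exists_maximal_mem (Y := Yᵒᵈ) hs hne

/-- A closed, densely ordered chain in a compact ordered space is preconnected. -/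
theorem isPreconnected_of_isClosed_of_dense_chain {Y : Type*} [TopologicalSpace Y] [CompactSpace Y]
    [PartialOrder Y] [OrderClosedTopology Y] {s : Set Y} (hs : IsClosed s)
    (hchain : ∀ a ∈ s, ∀ b ∈ s, a ≤ b ∨ b ≤ a)
    (hdense : ∀ a ∈ s, ∀ b ∈ s, a < b → ∃ c ∈ s, a < c ∧ c < b) : IsPreconnected s := by
  rw [isPreconnected_iff_subset_of_fully_disjoint_closed hs]
  have key : ∀ u v : Set Y, IsClosed u → IsClosed v → s ⊆ u ∪ v → Disjoint u v →
      ∀ a ∈ s, a ∈ v → ∀ b ∈ s, b ∈ u → a ≤ b → False := by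
    intro u v hu hv huv hd a has hav b hbs hbu hab
    rw [Set.disjoint_left] at hd
    -- The interval from `m` to `n` is a gap: a point of `s` strictly inside it would lie in `v`,
    -- against maximality of `m`, or in `u`, against minimality of `n`.
    obtain ⟨m, ⟨⟨hms, hmv⟩, hmb⟩, hm⟩ :=
      ((hs.inter hv).inter (isClosed_Iic (a := b))).isCompact.exists_maximal_mem
        ⟨a, ⟨has, hav⟩, hab⟩
    obtain ⟨n, ⟨⟨hns, hnu⟩, hmn, hnb⟩, hn⟩ :=
      ((hs.inter hu).inter (isClosed_Icc (a := m) (b := b))).isCompact.exists_minimal_mem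
        ⟨b, ⟨hbs, hbu⟩, hmb, le_rfl⟩
    have hlt : m < n := lt_of_le_of_ne hmn fun h => hd hnu (h ▸ hmv)
    obtain ⟨c, hcs, hmc, hcn⟩ := hdense m hms n hns hlt
    rcases huv hcs with hc | hc
    · exact hcn.not_ge (hn ⟨⟨hcs, hc⟩, hmc.le, hcn.le.trans hnb⟩ hcn.le)
    · exact hmc.not_ge (hm ⟨⟨hcs, hc⟩, hcn.le.trans hnb⟩ hmc.le)
  intro u v hu hv huv hd
  by_contra! h
  obtain ⟨a, has, hau⟩ := Set.not_subset.1 h.1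
  obtain ⟨b, hbs, hbv⟩ := Set.not_subset.1 h.2
  have hav := (huv has).resolve_left hau
  have hbu := (huv hbs).resolve_right hbv
  rcases hchain a has b hbs with hab | hba
  · exact key u v hu hv huv hd a has hav b hbs hbu hab
  · exact key v u hv hu (Set.union_comm u v ▸ huv) hd.symm b hbs hbu a has hav hba

/-- Boundary bumping: in a compact connected Hausdorff space, every proper subcontinuum is properly
contained in another proper subcontinuum. -/
theorem exists_isConnected_between_of_connectedSpace {Y : Type*} [TopologicalSpace Y]
    [CompactSpace Y] [T2Space Y] [ConnectedSpace Y] {K : Set Y} (hK : IsClosed K)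
    (hKc : IsConnected K) (hne : K ≠ Set.univ) :
    ∃ M : Set Y, IsClosed M ∧ IsConnected M ∧ K ⊂ M ∧ M ≠ Set.univ := by
  obtain ⟨x, hx⟩ := hKc.nonempty
  obtain ⟨y, hy⟩ := (Set.ne_univ_iff_exists_notMem K).1 hne
  obtain ⟨U, hU, hKU, hUy⟩ := normal_exists_closure_subset hK (isOpen_compl_singleton (x := y))
    (fun z hz h => hy (h ▸ hz))
  set T := closure U
  have hxT : x ∈ T := subset_closure (hKU hx)
  have hyT : y ∉ T := fun h => hUy h rfl
  have : CompactSpace T := isCompact_iff_compactSpace.1 isClosed_closure.isCompact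
  let Q := connectedComponent (⟨x, hxT⟩ : T)
  have hQ : IsClosed Q := isClosed_connectedComponent
  refine ⟨Subtype.val '' Q, (isClosed_closure.isClosedEmbedding_subtypeVal).isClosedMap _ hQ,
    isConnected_connectedComponent.image _ continuous_subtype_val.continuousOn, ?_, ?_⟩
  · have hsub : K ⊆ Subtype.val '' Q := by
      have hKT : K ⊆ T := hKU.trans subset_closure
      have := (IsInducing.subtypeVal.isPreconnected_image (s := (Subtype.val ⁻¹' K : Set T))).1 (by
        rw [Subtype.image_preimage_coe, Set.inter_eq_right.2 hKT]; exact hKc.isPreconnected)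
      intro z hz
      exact ⟨⟨z, hKT hz⟩, this.subset_connectedComponent (x := ⟨x, hxT⟩) hx hz, rfl⟩
    -- If the component `Q` were just `K`, it would lie in `U`. By compactness some clopen `E` of
    -- `T` containing `x` would too, and `E` would be clopen in the connected space `Y` while
    -- missing `y`.
    refine hsub.ssubset_of_ne fun heq => ?_
    have hQU : Q ⊆ Subtype.val ⁻¹' U := fun z hz => hKU (heq ▸ Set.mem_image_of_mem _ hz)
    have hQe : Q = ⋂ s : { s : Set T // IsClopen s ∧ (⟨x, hxT⟩ : T) ∈ s }, (s : Set T) :=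
      connectedComponent_eq_iInter_isClopen _
    rw [hQe] at hQU
    have : Nonempty { s : Set T // IsClopen s ∧ (⟨x, hxT⟩ : T) ∈ s } :=
      ⟨⟨Set.univ, isClopen_univ, trivial⟩⟩
    obtain ⟨⟨E, hE, hxE⟩, hEU⟩ := exists_subset_nhds_of_compactSpace
      (V := fun s : { s : Set T // IsClopen s ∧ (⟨x, hxT⟩ : T) ∈ s } => (s : Set T))
      (fun a b => ⟨⟨a.1 ∩ b.1, a.2.1.inter b.2.1, a.2.2, b.2.2⟩, Set.inter_subset_left,
        Set.inter_subset_right⟩) (fun s => s.2.1.isClosed)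
      (fun z hz => (hU.preimage continuous_subtype_val).mem_nhds (hQU hz))
    have hclopen : IsClopen (Subtype.val '' E) := by
      refine ⟨(isClosed_closure.isClosedEmbedding_subtypeVal).isClosedMap _ hE.1, ?_⟩
      obtain ⟨O, hO, rfl⟩ := isOpen_induced_iff.1 hE.2
      have : Subtype.val '' (Subtype.val ⁻¹' O : Set T) = O ∩ U := by
        ext z
        constructor
        · rintro ⟨w, hw, rfl⟩
          exact ⟨hw, hEU hw⟩
        · rintro ⟨h1, h2⟩
          exact ⟨⟨z, subset_closure h2⟩, h1, rfl⟩
      rw [this]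
      exact hO.inter hU
    have huniv := hclopen.eq_univ ⟨x, _, hxE, rfl⟩
    obtain ⟨w, -, hw⟩ := (huniv ▸ Set.mem_univ y : y ∈ Subtype.val '' E)
    exact hyT (hw ▸ w.2)
  · intro h
    obtain ⟨w, -, hw⟩ := (h ▸ Set.mem_univ y : y ∈ Subtype.val '' Q)
    exact hyT (hw ▸ w.2)

/-- The set contains the dense open set formed by `B` and the exterior of `B`. Thus membership in
`A` generically implies membership in `B`. -/
theorem union_compl_mem_residual {Y : Type*} [TopologicalSpace Y] {A B : Set Y} (hB : IsOpen B)
    (hAB : A ⊆ closure B) : B ∪ Aᶜ ∈ residual Y := by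
  refine Filter.mem_of_superset (residual_of_dense_open (hB.union isClosed_closure.isOpen_compl) ?_)
    (Set.union_subset_union_right B (Set.compl_subset_compl.2 hAB))
  intro z
  by_cases hz : z ∈ closure B
  · exact closure_mono Set.subset_union_left hz
  · exact subset_closure (Or.inr hz)

/-! ### The hyperspace of subcontinua -/

namespace Subcontinua

variable {X : Type*} [TopologicalSpace X]

theorem le_def {K L : Subcontinua X} : K ≤ L ↔ K.pts ⊆ L.pts := Iff.rfl

theorem pts_injective : Function.Injective (pts (X := X)) :=
  SetLike.coe_injective.comp Subtype.val_injective

/-- The subcontinuum with a given set of points. -/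
def ofSet (s : Set X) (hs : IsCompact s) (hc : IsConnected s) : Subcontinua X :=
  ⟨⟨⟨s, hs⟩, hc.nonempty⟩, hc⟩

/-- The degenerate subcontinuum at a point. -/
def point (x : X) : Subcontinua X := ⟨{x}, isConnected_singleton⟩

theorem continuous_point : Continuous (point (X := X)) :=
  NonemptyCompacts.continuous_singleton.subtype_mk _

theorem isOpen_inter_nonempty {U : Set X} (hU : IsOpen U) :
    IsOpen {K : Subcontinua X | (K.pts ∩ U).Nonempty} :=
  (NonemptyCompacts.isOpen_inter_nonempty_of_isOpen hU).preimage continuous_subtype_val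

theorem isOpen_subset {U : Set X} (hU : IsOpen U) : IsOpen {K : Subcontinua X | K.pts ⊆ U} :=
  (NonemptyCompacts.isOpen_subsets_of_isOpen hU).preimage continuous_subtype_val

theorem isClosed_inter_nonempty {F : Set X} (hF : IsClosed F) :
    IsClosed {K : Subcontinua X | (K.pts ∩ F).Nonempty} :=
  (NonemptyCompacts.isClosed_inter_nonempty_of_isClosed hF).preimage continuous_subtype_val

instance compactSpace [T2Space X] [CompactSpace X] : CompactSpace (Subcontinua X) := by
  suffices h : IsClosed {K : NonemptyCompacts X | IsConnected (K : Set X)} from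
    isCompact_iff_compactSpace.1 h.isCompact
  rw [← isOpen_compl_iff, isOpen_iff_mem_nhds]
  intro K hK
  have hK' : ¬ IsPreconnected (K : Set X) := fun h => hK ⟨K.nonempty, h⟩
  rw [isPreconnected_iff_subset_of_fully_disjoint_closed K.isCompact.isClosed] at hK'
  push Not at hK'
  obtain ⟨u, v, hu, hv, huv, hd, hKu, hKv⟩ := hK'
  obtain ⟨U, V, hU, hV, huU, hvV, hUV⟩ := normal_separation hu hv hd
  obtain ⟨a, ha, hau⟩ := Set.not_subset.1 hKu
  obtain ⟨b, hb, hbv⟩ := Set.not_subset.1 hKv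
  filter_upwards [(NonemptyCompacts.isOpen_subsets_of_isOpen (hU.union hV)).mem_nhds
      (show (K : Set X) ⊆ U ∪ V from huv.trans (Set.union_subset_union huU hvV)),
    (NonemptyCompacts.isOpen_inter_nonempty_of_isOpen hV).mem_nhds
      (show ((K : Set X) ∩ V).Nonempty from ⟨a, ha, hvV ((huv ha).resolve_left hau)⟩),
    (NonemptyCompacts.isOpen_inter_nonempty_of_isOpen hU).mem_nhds
      (show ((K : Set X) ∩ U).Nonempty from ⟨b, hb, huU ((huv hb).resolve_right hbv)⟩)]
    with L h1 h2 h3 hL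
  obtain ⟨z, -, hzU, hzV⟩ := hL.isPreconnected U V hU hV h1 h3 h2
  exact Set.disjoint_left.1 hUV hzU hzV

instance orderClosedTopology [T2Space X] [CompactSpace X] : OrderClosedTopology (Subcontinua X) := by
  constructor
  rw [← isOpen_compl_iff, isOpen_iff_mem_nhds]
  rintro ⟨K, L⟩ hKL
  obtain ⟨x, hxK, hxL⟩ := Set.not_subset.1 (show ¬ K.pts ⊆ L.pts from hKL)
  obtain ⟨U, V, hU, hV, hxU, hLV, hUV⟩ := normal_separation
    (isClosed_singleton (x := x)) L.1.isCompact.isClosed (Set.disjoint_singleton_left.2 hxL)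
  filter_upwards [prod_mem_nhds
    ((isOpen_inter_nonempty hU).mem_nhds ⟨x, hxK, hxU rfl⟩) ((isOpen_subset hV).mem_nhds hLV)]
  rintro ⟨K', L'⟩ ⟨⟨y, hy, hyU⟩, hL'⟩ hle
  exact Set.disjoint_left.1 hUV hyU (hL' (hle hy))

theorem point_le {x : X} {K : Subcontinua X} : point x ≤ K ↔ x ∈ K.pts :=
  Set.singleton_subset_iff

theorem isClosed_setOf_mem [T2Space X] [CompactSpace X] (x : X) :
    IsClosed {K : Subcontinua X | x ∈ K.pts} := by
  have : {K : Subcontinua X | x ∈ K.pts} = Set.Ici (point x) := Set.ext fun _ => point_le.symm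
  exact this ▸ isClosed_Ici

/-- Boundary bumping: `Cont(X)` is densely ordered by inclusion. -/
theorem exists_between [T2Space X] [CompactSpace X] {K L : Subcontinua X} (h : K < L) :
    ∃ M : Subcontinua X, K < M ∧ M < L := by
  have hsub : K.pts ⊂ L.pts := h
  have : CompactSpace L.pts := isCompact_iff_compactSpace.1 L.1.isCompact
  have : ConnectedSpace L.pts := isConnected_iff_connectedSpace.1 L.2
  obtain ⟨M, hM, hMc, hKM, hMu⟩ := exists_isConnected_between_of_connectedSpace
    (Y := L.pts) (K := Subtype.val ⁻¹' K.pts)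
    (K.1.isCompact.isClosed.preimage continuous_subtype_val) (by
      refine ⟨K.1.nonempty.elim fun x hx => ⟨⟨x, hsub.1 hx⟩, hx⟩,
        IsInducing.subtypeVal.isPreconnected_image.1 ?_⟩
      rw [Subtype.image_preimage_coe, Set.inter_eq_right.2 hsub.1]
      exact K.2.isPreconnected) (fun hu => by
      obtain ⟨y, hyL, hyK⟩ := Set.exists_of_ssubset hsub
      exact hyK (hu ▸ Set.mem_univ (⟨y, hyL⟩ : L.pts) : (⟨y, hyL⟩ : L.pts) ∈ Subtype.val ⁻¹' K.pts))
  have hML : Subtype.val '' M ⊂ L.pts := by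
    refine ⟨Subtype.coe_image_subset _ _, fun hle => hMu (Set.eq_univ_of_forall fun y => ?_)⟩
    obtain ⟨w, hw, hwy⟩ := hle y.2
    exact Subtype.val_injective hwy ▸ hw
  have hKM' : K.pts ⊂ Subtype.val '' M := by
    refine ⟨fun y hy => ⟨⟨y, hsub.1 hy⟩, hKM.1 hy, rfl⟩, fun hle => hKM.2 fun y hy => ?_⟩
    exact hle ⟨y, hy, rfl⟩
  exact ⟨ofSet _ (hM.isCompact.image continuous_subtype_val)
    (hMc.image _ continuous_subtype_val.continuousOn), hKM', hML⟩

/-- Otherwise the union would be a subcontinuum decomposed into two proper ones. -/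
theorem subset_or_subset_of_hereditarilyIndecomposable
    (hX : IsHereditarilyIndecomposable X) {K L : Subcontinua X} (h : (K.pts ∩ L.pts).Nonempty) :
    K ≤ L ∨ L ≤ K := by
  by_contra! hne
  obtain ⟨x, hxK, hxL⟩ := h
  let N : Subcontinua X := ofSet (K.pts ∪ L.pts) (K.1.isCompact.union L.1.isCompact)
    (K.2.union ⟨x, hxK, hxL⟩ L.2)
  have key : ∀ A : Subcontinua X, A.pts ⊆ N.pts →
      ∃ B : Subcontinua N.pts, B.pts = Subtype.val ⁻¹' A.pts := fun A hA => by
    have him : Subtype.val '' (Subtype.val ⁻¹' A.pts : Set N.pts) = A.pts := by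
      rw [Subtype.image_preimage_coe, Set.inter_eq_right.2 hA]
    refine ⟨ofSet (Subtype.val ⁻¹' A.pts) ?_ ⟨?_, ?_⟩, rfl⟩
    · rw [IsInducing.subtypeVal.isCompact_iff, him]
      exact A.1.isCompact
    · exact A.1.nonempty.elim fun y hy => ⟨⟨y, hA hy⟩, hy⟩
    · rw [← IsInducing.subtypeVal.isPreconnected_image, him]
      exact A.2.isPreconnected
  obtain ⟨A, hA⟩ := key K Set.subset_union_left
  obtain ⟨B, hB⟩ := key L Set.subset_union_right
  refine hX N ⟨A, B, fun hu => hne.2 fun y hy => ?_, fun hu => hne.1 fun y hy => ?_, ?_⟩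
  · exact (hA ▸ hu ▸ Set.mem_univ (⟨y, Or.inr hy⟩ : N.pts) :)
  · exact (hB ▸ hu ▸ Set.mem_univ (⟨y, Or.inl hy⟩ : N.pts) :)
  · rw [hA, hB]
    exact Set.eq_univ_of_forall fun y => y.2

theorem isConnected_setOf_mem [T2Space X] [CompactSpace X]
    (hX : IsHereditarilyIndecomposable X) (x : X) :
    IsConnected {K : Subcontinua X | x ∈ K.pts} := by
  refine ⟨⟨point x, rfl⟩, ?_⟩
  refine isPreconnected_of_isClosed_of_dense_chain (isClosed_setOf_mem x) ?_ ?_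
  · exact fun K hK L hL => subset_or_subset_of_hereditarilyIndecomposable hX ⟨x, hK, hL⟩
  · intro K hK L _ hKL
    obtain ⟨M, h1, h2⟩ := exists_between hKL
    exact ⟨M, h1.le hK, h1, h2⟩

end Subcontinua

/-! ### The space of maximal order arcs -/

namespace MOA

open Subcontinua

variable {X : Type*} [TopologicalSpace X]

theorem exists_point_mem (C : MOA X) : ∃ x, point x ∈ C.1.pts := by
  obtain ⟨x, K, hK, hx⟩ := C.2.2.2
  exact ⟨x, (pts_injective hx : K = point x) ▸ hK⟩

/-- The point at which a maximal order arc starts. -/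
noncomputable def root (C : MOA X) : X := C.exists_point_mem.choose

theorem point_root_mem (C : MOA X) : point C.root ∈ C.1.pts := C.exists_point_mem.choose_spec

theorem root_eq_iff {C : MOA X} {x : X} : C.root = x ↔ point x ∈ C.1.pts := by
  refine ⟨fun h => h ▸ C.point_root_mem, fun h => ?_⟩
  rcases C.2.1 _ C.point_root_mem _ h with h | h
  · exact Set.singleton_subset_singleton.1 h
  · exact (Set.singleton_subset_singleton.1 h).symm

theorem root_mem {C : MOA X} {K : Subcontinua X} (hK : K ∈ C.1.pts) : C.root ∈ K.pts := by
  rcases C.2.1 _ C.point_root_mem _ hK with h | h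
  · exact h rfl
  · obtain ⟨y, hy⟩ := K.1.nonempty
    exact (h hy : y = C.root) ▸ hy

theorem pts_eq [T2Space X] [CompactSpace X] (hX : IsHereditarilyIndecomposable X) (C : MOA X) :
    C.1.pts = {K | C.root ∈ K.pts} := by
  refine Set.Subset.antisymm (fun K hK => root_mem hK) fun L hL => ?_
  by_contra hLC
  obtain ⟨T, hT, hTu⟩ := C.2.2.1
  -- Every element of the arc is comparable with `L`, since both contain the root. The connected arc
  -- cannot jump over `L`.
  obtain ⟨M, hM, hM1, hM2⟩ := isPreconnected_closed_iff.1 C.1.2.isPreconnected (Set.Iic L)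
    (Set.Ici L) isClosed_Iic isClosed_Ici
    (fun K hK => subset_or_subset_of_hereditarilyIndecomposable hX ⟨_, root_mem hK, hL⟩)
    ⟨_, C.point_root_mem, point_le.2 hL⟩
    ⟨T, hT, le_def.2 (hTu ▸ Set.subset_univ _)⟩
  have hML : M = L := le_antisymm (Set.mem_Iic.1 hM1) (Set.mem_Ici.1 hM2)
  exact hLC (hML ▸ hM)

/-- In a hereditarily indecomposable continuum, the subcontinua through a point form a maximal
order arc. -/
def ofPoint [T2Space X] [CompactSpace X] [ConnectedSpace X]
    (hX : IsHereditarilyIndecomposable X) (x : X) : MOA X :=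
  ⟨Subcontinua.ofSet {K | x ∈ K.pts} (isClosed_setOf_mem x).isCompact (isConnected_setOf_mem hX x),
    fun _ hK _ hL => subset_or_subset_of_hereditarilyIndecomposable hX ⟨x, hK, hL⟩,
    ⟨Subcontinua.ofSet Set.univ isCompact_univ isConnected_univ, Set.mem_univ x, rfl⟩,
    x, point x, Set.mem_singleton x, rfl⟩

instance compactSpace [T2Space X] [CompactSpace X] [ConnectedSpace X] : CompactSpace (MOA X) := by
  let T : Subcontinua X := Subcontinua.ofSet Set.univ isCompact_univ isConnected_univ
  have h1 : IsClosed {C : Subcontinua (Subcontinua X) | IsOrderArc C} := by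
    have hc : Continuous fun C : Subcontinua (Subcontinua X) => C.1 ×ˢ C.1 :=
      NonemptyCompacts.continuous_prod.comp (continuous_subtype_val.prodMk continuous_subtype_val)
    have hR : IsClosed {p : Subcontinua X × Subcontinua X | p.1 ≤ p.2 ∨ p.2 ≤ p.1} :=
      (OrderClosedTopology.isClosed_le' (α := Subcontinua X)).union
        ((OrderClosedTopology.isClosed_le' (α := Subcontinua X)).preimage continuous_swap)
    convert (NonemptyCompacts.isClosed_subsets_of_isClosed hR).preimage hc using 1
    ext C
    exact ⟨fun h p hp => h p.1 hp.1 p.2 hp.2, fun h K hK L hL => h (Set.mk_mem_prod hK hL)⟩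
  have h2 : IsClosed {C : Subcontinua (Subcontinua X) | ∃ K ∈ C.pts, K.pts = Set.univ} := by
    convert isClosed_inter_nonempty (isClosed_singleton (x := T)) using 1
    ext C
    exact exists_congr fun K => and_congr_right fun _ => pts_injective.eq_iff (b := T)
  have h3 : IsClosed {C : Subcontinua (Subcontinua X) | ∃ x : X, ∃ K ∈ C.pts, K.pts = {x}} := by
    convert isClosed_inter_nonempty (isCompact_range (continuous_point (X := X))).isClosed using 1
    ext C
    constructor
    · rintro ⟨x, K, hK, hx⟩
      exact ⟨K, hK, x, pts_injective hx.symm⟩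
    · rintro ⟨K, hK, x, rfl⟩
      exact ⟨x, _, hK, rfl⟩
  exact isCompact_iff_compactSpace.1 (h1.inter (h2.inter h3)).isCompact

theorem continuous_root [T2Space X] [CompactSpace X] : Continuous (root (X := X)) := by
  refine continuous_iff_isClosed.2 fun F hF => ?_
  convert (isClosed_inter_nonempty (hF.isCompact.image continuous_point).isClosed).preimage
    (continuous_subtype_val (p := IsMaximalOrderArc (X := X))) using 1
  ext C
  constructor
  · exact fun h => ⟨_, C.point_root_mem, _, h, rfl⟩
  · rintro ⟨_, hK, x, hx, rfl⟩
    exact Set.mem_preimage.2 ((root_eq_iff.2 hK).symm ▸ hx)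

/-- The space of maximal order arcs of a hereditarily indecomposable continuum is homeomorphic to
the continuum. -/
noncomputable def homeomorph [T2Space X] [CompactSpace X] [ConnectedSpace X]
    (hX : IsHereditarilyIndecomposable X) : MOA X ≃ₜ X :=
  Continuous.homeoOfEquivCompactToT2 (f :=
    { toFun := root
      invFun := ofPoint hX
      left_inv := fun C => Subtype.ext (pts_injective (C.pts_eq hX).symm)
      right_inv := fun x => root_eq_iff.2 (Set.mem_singleton x) }) continuous_root

end MOA

/-! ### Generic subcontinua -/

namespace Subcontinua

variable {X : Type*} [TopologicalSpace X] [T2Space X] [CompactSpace X] [ConnectedSpace X]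

/-- Hereditarily indecomposable continua have the property of Kelley. -/
theorem isOpen_setOf_exists_mem (hX : IsHereditarilyIndecomposable X) {W : Set (Subcontinua X)}
    (hW : IsOpen W) : IsOpen {x : X | ∃ K ∈ W, x ∈ K.pts} := by
  -- A point is covered by `W` exactly when its maximal order arc meets `W`, an open condition on
  -- the arc.
  convert ((isOpen_inter_nonempty hW).preimage continuous_subtype_val).preimage
    (MOA.homeomorph hX).symm.continuous using 1
  ext x
  exact exists_congr fun K => and_comm

theorem setOf_inter_nonempty_subset_closure (hX : IsHereditarilyIndecomposable X) {U V : Set X}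
    (hU : Dense U) (hV : IsOpen V) :
    {K : Subcontinua X | (K.pts ∩ V).Nonempty} ⊆
      closure {K : Subcontinua X | (K.pts ∩ (V ∩ U)).Nonempty} := by
  rintro K ⟨x, hxK, hxV⟩
  refine mem_closure_iff.2 fun W hW hKW => ?_
  obtain ⟨y, ⟨⟨L, hL, hyL⟩, hyV⟩, hyU⟩ := hU.inter_open_nonempty _
    ((isOpen_setOf_exists_mem hX hW).inter hV) ⟨x, ⟨K, hKW, hxK⟩, hxV⟩
  exact ⟨L, hL, y, hyL, hyV, hyU⟩

theorem inter_nonempty_mem_residual [SecondCountableTopology X]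
    (hX : IsHereditarilyIndecomposable X) {G : Set X} (hG : G ∈ residual X) :
    {K : Subcontinua X | (K.pts ∩ G).Nonempty} ∈ residual (Subcontinua X) := by
  obtain ⟨S, hSo, hSd, hSc, hSG⟩ := mem_residual_iff.1 hG
  have hB := countable_countableBasis X
  have key : ⋂ U ∈ S, ⋂ V ∈ countableBasis X,
      ({K : Subcontinua X | (K.pts ∩ (V ∩ U)).Nonempty} ∪
        {K : Subcontinua X | (K.pts ∩ V).Nonempty}ᶜ) ∈ residual (Subcontinua X) :=
    (countable_bInter_mem hSc).2 fun U hU => (countable_bInter_mem hB).2 fun V hV =>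
      union_compl_mem_residual
        (isOpen_inter_nonempty ((isOpen_of_mem_countableBasis hV).inter (hSo U hU)))
        (setOf_inter_nonempty_subset_closure hX (hSd U hU) (isOpen_of_mem_countableBasis hV))
  filter_upwards [key] with K hK
  simp only [Set.mem_iInter] at hK
  have : CompactSpace K.pts := isCompact_iff_compactSpace.1 K.1.isCompact
  have : Nonempty K.pts := K.1.nonempty.to_subtype
  -- Baire's theorem in the compact Hausdorff space `K`; density of each trace is tested on the
  -- countable basis.
  have hd : Dense (⋂ U ∈ S, (Subtype.val ⁻¹' U : Set K.pts)) := by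
    refine dense_biInter_of_isOpen (fun U hU => (hSo U hU).preimage continuous_subtype_val) hSc
      fun U hU => ?_
    refine dense_iff_inter_open.2 ?_
    rintro O hO ⟨x, hx⟩
    obtain ⟨O, hO', rfl⟩ := isOpen_induced_iff.1 hO
    obtain ⟨V, hV, hxV, hVO⟩ := (isBasis_countableBasis X).exists_subset_of_mem_open hx hO'
    obtain ⟨y, hyK, hyV, hyU⟩ := (hK U hU V hV).resolve_right fun h => h ⟨x, x.2, hxV⟩
    exact ⟨⟨y, hyK⟩, hVO hyV, hyU⟩
  obtain ⟨y, hy⟩ := hd.nonempty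
  exact ⟨y, y.2, hSG fun U hU => Set.mem_iInter₂.1 hy U hU⟩

theorem nontrivial_mem_residual [Nontrivial X] (hX : IsHereditarilyIndecomposable X) :
    {K : Subcontinua X | K.pts.Nontrivial} ∈ residual (Subcontinua X) := by
  have hnot : ∀ K : Subcontinua X, ¬ K.pts.Nontrivial ↔ K ∈ Set.range (point (X := X)) := by
    intro K
    rw [Set.not_nontrivial_iff]
    constructor
    · intro h
      obtain ⟨x, hx⟩ := K.1.nonempty
      exact ⟨x, pts_injective (h.eq_singleton_of_mem hx).symm⟩
    · rintro ⟨x, rfl⟩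
      exact Set.subsingleton_singleton
  refine residual_of_dense_open ?_ fun K => ?_
  · convert (isCompact_range (continuous_point (X := X))).isClosed.isOpen_compl using 1
    ext K
    exact (not_iff_comm.1 (hnot K)).symm
  · by_cases hK : K.pts.Nontrivial
    · exact subset_closure hK
    obtain ⟨x, rfl⟩ := (hnot K).1 hK
    refine mem_closure_iff.2 fun W hW hxW => ?_
    by_contra hne
    have hsub : ∀ L ∈ W, x ∈ L.pts → L = point x := fun L hL hxL => by
      obtain ⟨y, rfl⟩ := (hnot L).1 fun h => hne ⟨L, hL, h⟩
      exact congrArg point (hxL : x = y).symm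
    -- Otherwise `point x` would be isolated in the connected family of subcontinua through `x`,
    -- which also contains the whole space.
    obtain ⟨y, hy⟩ := exists_ne x
    obtain ⟨L, hxL, hLW, hL⟩ := (isConnected_setOf_mem hX x).isPreconnected W {point x}ᶜ hW
      isOpen_compl_singleton
      (fun L hxL => (em (L = point x)).elim (fun h => Or.inl (h ▸ hxW)) Or.inr)
      ⟨point x, rfl, hxW⟩
      ⟨ofSet Set.univ isCompact_univ isConnected_univ, Set.mem_univ x, fun h =>
        hy ((congrArg pts h).subset (Set.mem_univ y))⟩
    exact hL (hsub L hLW hxL)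

end Subcontinua

theorem mainTheorem10 (X : Type*) [TopologicalSpace X] [MetrizableSpace X] [CompactSpace X]
    [ConnectedSpace X] (hX : IsHereditarilyIndecomposable X) (hG : GCHEC X) : GHEC X := by
  have : SecondCountableTopology X := by
    let := metrizableSpaceMetric X
    infer_instance
  rcases subsingleton_or_nontrivial X with hs | hn
  · refine Filter.mem_of_superset Filter.univ_mem fun K _ => ?_
    have hK : K.pts = Set.univ := Subsingleton.eq_univ_of_nonempty K.1.nonempty
    exact ⟨(Homeomorph.setCongr hK).trans (Homeomorph.Set.univ X)⟩
  · have hGX := tendsto_residual_of_isOpenMap (MOA.homeomorph hX).symm.continuous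
      (MOA.homeomorph hX).symm.isOpenMap hG
    filter_upwards [Subcontinua.inter_nonempty_mem_residual hX hGX,
      Subcontinua.nontrivial_mem_residual hX]
    rintro K ⟨x, hxK, hx⟩ hK
    exact hx K hxK hK
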